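/- **Theorem (Runtime of the MMAHH).** For $n \ge 1$ and $x \in \{0,1\}^n$ let $x^* = (1,\dots,1)$ and let $L_h = \{x \in \{0,1\}^n : n - \|x\|_1 = h\}$ be the set of bit strings at Hamming distance $h$ from $x^*$. For integers $n \ge 2$, $0 \le k \le n-2$ and $n = d_0 > d_1 > \dots > d_k > d_{k+1} = 0$, let $\mathrm{SEQOPT}_k(d_1,\dots,d_k)$ be the set of all $f : \{0,1\}^n \to \mathbb{R}$ such that $x^*$ is the unique global maximum of $f$ and, for every $\ell \in \{0,\dots,k\}$, every $h$ with $d_{\ell+1} \le h < d_\ell$, every $x \in L_h$ and every $y \in L_{h+1}$, one has $f(x) > f(y)$ if $k-\ell$ is even and $f(x) < f(y)$ if $k - \ell$ is odd. The Markov move-acceptance hyper-heuristic (MMAHH) with switching probabilities $p,q\in(0,1)$ on $f : \{0,1\}^n \to \mathbb{R}$ is the random process $(x_t,s_t)_{t\ge 0}$ in $\{0,1\}^n\times\{\mathrm{OI},\mathrm{OW}\}$ in which $x_0$ is uniform on $\{0,1\}^n$, $s_0=\mathrm{OI}$, and in each iteration $t$: a string $x'$ is obtained from $x_t$ by flipping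 one uniformly chosen bit; $x_{t+1}=x'$ if ($s_t=\mathrm{OI}$ and $f(x')>f(x_t)$) or ($s_t=\mathrm{OW}$ and $f(x')<f(x_t)$), and $x_{t+1}=x_t$ otherwise; independently, $s_{t+1}\neq s_t$ with probability $p$ if $s_t=\mathrm{OI}$ and with probability $q$ if $s_t=\mathrm{OW}$, and $s_{t+1}=s_t$ otherwise. Its runtime is $T=\inf\{t\ge 0 : x_t=x^*\}$. Suppose that $p, q = \Theta\!\left(\frac{1}{n\log n}\right)$ and $k=O(1)$ as $n\to\infty$. Then, uniformly over all $f \in \mathrm{SEQOPT}_k(d_1,\dots,d_k)$, the expected runtime of the MMAHH on $f$ satisfies $$\mathrm{E}[T] = O\!\left(\frac{n^{k+1}}{d_1\cdots d_k}\,\log n\right).$$ That is: for all $K\in\mathbb{N}$ and $c_1,c_2>0$ there are $C>0$ and $N\in\mathbb{N}$ such that for all $n\ge N$, all $p,q\in(0,1)$ with $\frac{c_1}{n\log n}\le p,q\le \frac{c_2}{n\log n}$, all $k\le K$, all $n>d_1>\dots>d_k>0$ with $k\le n-2$ and all $f\in \mathrm{SEQOPT}_k(d_1,\dots,d_k)$,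 one has $\mathrm{E}[T]\le C\,\frac{n^{k+1}}{d_1\cdots d_k}\log n$. -/

import Mathlib

open MeasureTheory

/-- Bit strings of length `n`. -/
abbrev BitString (n : ℕ) : Type := Fin n → Bool

/-- The all-ones string `x* = (1, …, 1)`. -/
def allOnes (n : ℕ) : BitString n := fun _ => true

/-- The `h`-th layer: the bit strings at Hamming distance `h` from `x*`. -/
def layer (n h : ℕ) : Set (BitString n) := {x | hammingDist x (allOnes n) = h}

/-- `f` is increasing between layer `h + 1` and layer `h` (that is, towards `x*`). -/
def IncreasingAt {n : ℕ} (f : BitString n → ℝ) (h : ℕ) : Prop :=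
  ∀ x ∈ layer n h, ∀ y ∈ layer n (h + 1), f y < f x

/-- `f` is decreasing between layer `h + 1` and layer `h` (that is, towards `x*`). -/
def DecreasingAt {n : ℕ} (f : BitString n → ℝ) (h : ℕ) : Prop :=
  ∀ x ∈ layer n h, ∀ y ∈ layer n (h + 1), f x < f y

/-- `f ∈ SEQOPT_k(d₁, …, d_k)`, where `d 0 = n > d 1 > ⋯ > d k > d (k + 1) = 0`
(the values of `d` beyond `k + 1` play no role). -/
structure SeqOpt (n k : ℕ) (d : ℕ → ℕ) (f : BitString n → ℝ) : Prop where
  two_le : 2 ≤ n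
  le_sub_two : k ≤ n - 2
  d_zero : d 0 = n
  d_last : d (k + 1) = 0
  d_lt : ∀ l ≤ k, d (l + 1) < d l
  unique_max : ∀ x, x ≠ allOnes n → f x < f (allOnes n)
  increasing : ∀ l ≤ k, Even (k - l) → ∀ h, d (l + 1) ≤ h → h < d l → IncreasingAt f h
  decreasing : ∀ l ≤ k, Odd (k - l) → ∀ h, d (l + 1) ≤ h → h < d l → DecreasingAt f h

/-- The two acceptance operators: only-improving and only-worsening. -/
inductive AcceptOp : Type
  | OI
  | OW
  deriving DecidableEq

instance : Fintype AcceptOp := ⟨{AcceptOp.OI, AcceptOp.OW}, fun s => by cases s <;> simp⟩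

instance : MeasurableSpace AcceptOp := ⊤

/-- Acceptance of a move from a solution of value `a` to a solution of value `b`. -/
def AcceptOp.Accepts : AcceptOp → ℝ → ℝ → Prop
  | .OI, a, b => a < b
  | .OW, a, b => b < a

/-- Flip the `v`-th bit of `x`. -/
def flipBit {n : ℕ} (x : BitString n) (v : Fin n) : BitString n :=
  Function.update x v (!x v)

open Classical in
/-- The next solution if the `v`-th bit is chosen to be flipped while operator `s` is in use. -/
noncomputable def nextSolution {n : ℕ} (f : BitString n → ℝ) (s : AcceptOp) (x : BitString n)
    (v : Fin n) : BitString n :=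
  if s.Accepts (f x) (f (flipBit x v)) then flipBit x v else x

/-- Probability that the next solution is `y` if the current one is `x`, the current operator is
`s`, and the flipped bit is chosen uniformly at random. -/
noncomputable def moveProb {n : ℕ} (f : BitString n → ℝ) (s : AcceptOp) (x y : BitString n) : ℝ :=
  (Finset.univ.filter fun v : Fin n => nextSolution f s x v = y).card / n

/-- Transition probabilities of the two-state chain that selects the operators. -/
def switchProb (p q : ℝ) : AcceptOp → AcceptOp → ℝ
  | .OI, .OI => 1 - p
  | .OI, .OW => p
  | .OW, .OW => 1 - q
  | .OW, .OI => q

/-- The random sequence `(X t, S t)` of solutions and operators is a run of the MMAHH on `f` with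
switching probabilities `p` (from OI to OW) and `q` (from OW to OI): `X 0` is uniform, `S 0 = OI`,
and given the history up to time `t`, the next solution and the next operator are drawn
independently of each other with the probabilities `moveProb` and `switchProb`. -/
structure IsMMAHHRun {n : ℕ} (p q : ℝ) (f : BitString n → ℝ) {Ω : Type*} [MeasurableSpace Ω]
    (μ : Measure Ω) (X : ℕ → Ω → BitString n) (S : ℕ → Ω → AcceptOp) : Prop where
  measurable_X : ∀ t, Measurable (X t)
  measurable_S : ∀ t, Measurable (S t)
  initial : ∀ x, μ.real {ω | X 0 ω = x ∧ S 0 ω = AcceptOp.OI} = 1 / 2 ^ n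
  step : ∀ (t : ℕ) (x : ℕ → BitString n) (s : ℕ → AcceptOp),
    μ.real {ω | ∀ i ≤ t + 1, X i ω = x i ∧ S i ω = s i} =
      μ.real {ω | ∀ i ≤ t, X i ω = x i ∧ S i ω = s i} *
        (moveProb f (s t) (x t) (x (t + 1)) * switchProb p q (s t) (s (t + 1)))

/-- The runtime `T = inf {t ≥ 0 | x_t = x*}`, with `T = ∞` if `x*` is never reached. -/
noncomputable def runtime {n : ℕ} {Ω : Type*} (X : ℕ → Ω → BitString n) (ω : Ω) : ℕ∞ :=
  ⨅ (t : ℕ) (_ : X t ω = allOnes n), (t : ℕ∞)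

/-- The expected runtime `E[T] ∈ [0, ∞]`. -/
noncomputable def expectedRuntime {n : ℕ} {Ω : Type*} [MeasurableSpace Ω] (μ : Measure Ω)
    (X : ℕ → Ω → BitString n) : ENNReal :=
  ∫⁻ ω, (runtime X ω : ENNReal) ∂μ

/-! The proof is an additive drift argument on the pair (solution, operator). Only the distance `h`
to the optimum matters: in the segment `d (l + 1) < h ≤ d l` the "good" operator is the one that
accepts steps towards the optimum from there, and it alternates from one segment to the next. The
function `potential` is a lower-bound surrogate for the chance to reach the optimum without a
setback. It lies in [0, 1], equals 1 at the optimum, and grows in expectation by at least δ = ρ ·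
`discount n` · `passWeight 0` elsewhere, where ρ ≤ p, q. Drift applied to `1 - potential` gives E[T]
≤ 1 / δ.

Two factors make up the potential. The discount pays for the risk of an operator switch during a
descent: progress from distance j has probability j / n, a switch at most P, so step j costs a
factor (1 + 3nP / j)⁻¹. With P of order 1 / (n log n), the harmonic sum keeps the whole product
bounded below by a constant.

The pass weight pays for the layers `d l`. For l ≥ 1, a descent with the good operator of segment l
- 1 gets stuck at `d l`; once the operator switches, moves in both directions are accepted, and the
right one has probability `d l / n`. Each such layer costs a factor `d l / (4 * n)`. The product of
these factors gives n ^ k / (d 1 ⋯ d k), and 1 / ρ gives the remaining n log n. -/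

section Drift

/-! ### Additive drift for a finite Markov chain. -/

variable {Ω α : Type*} [MeasurableSpace Ω]

theorem measureReal_eq_sum_inter_fiber {β : Type*} [Fintype β] [MeasurableSpace β]
    [MeasurableSingletonClass β] (μ : Measure Ω) [IsFiniteMeasure μ] {Y : Ω → β}
    (hY : Measurable Y) (A : Set Ω) :
    μ.real A = ∑ y, μ.real (Y ⁻¹' {y} ∩ A) := by
  have h := sum_measureReal_preimage_singleton (μ := μ.restrict A) Finset.univ (f := Y)
    (fun y _ => hY (measurableSet_singleton y))
  simp only [Finset.coe_univ, Set.preimage_univ, measureReal_restrict_apply_univ] at h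
  rw [← h]
  exact Finset.sum_congr rfl fun y _ =>
    measureReal_restrict_apply (hY (measurableSet_singleton y))

variable [Fintype α] [MeasurableSpace α] [MeasurableSingletonClass α]

/-- The event that the process `Z` stays outside `B` up to time `t`. -/
def avoidSet (Z : ℕ → Ω → α) (B : Set α) (t : ℕ) : Set Ω := {ω | ∀ i ≤ t, Z i ω ∉ B}

theorem measurableSet_avoidSet {Z : ℕ → Ω → α} (hZ : ∀ t, Measurable (Z t)) (B : Set α) (t : ℕ) :
    MeasurableSet (avoidSet Z B t) := by
  have : avoidSet Z B t = ⋂ i, ⋂ (_ : i ≤ t), Z i ⁻¹' Bᶜ := by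
    ext ω; simp [avoidSet]
  rw [this]
  exact MeasurableSet.iInter fun i => MeasurableSet.iInter fun _ => hZ i (Set.toFinite _).measurableSet

/-- The one-step Markov property extends from single histories to the avoidance event because that
event is a disjoint union of histories up to time `t`. -/
theorem measureReal_avoidSet_step (μ : Measure Ω) [IsFiniteMeasure μ] {Z : ℕ → Ω → α}
    (hZ : ∀ t, Measurable (Z t)) {P : α → α → ℝ}
    (hstep : ∀ (t : ℕ) (z : ℕ → α), μ.real {ω | ∀ i ≤ t + 1, Z i ω = z i} =
      μ.real {ω | ∀ i ≤ t, Z i ω = z i} * P (z t) (z (t + 1)))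
    (B : Set α) (t : ℕ) (a b : α) :
    μ.real (avoidSet Z B t ∩ {ω | Z t ω = a} ∩ {ω | Z (t + 1) ω = b}) =
      μ.real (avoidSet Z B t ∩ {ω | Z t ω = a}) * P a b := by
  classical
  set Y : Ω → (Fin (t + 1) → α) := fun ω i => Z i ω with hYdef
  have hY : Measurable Y := measurable_pi_lambda _ fun i => hZ i
  rw [measureReal_eq_sum_inter_fiber μ hY, measureReal_eq_sum_inter_fiber μ hY (avoidSet Z B t ∩ _),
    Finset.sum_mul]
  refine Finset.sum_congr rfl fun y _ => ?_
  by_cases hy : (∀ i, y i ∉ B) ∧ y (Fin.last t) = a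
  · set z : ℕ → α := fun i => if h : i < t + 1 then y ⟨i, h⟩ else b with hz
    have hz1 : ∀ i (h : i < t + 1), z i = y ⟨i, h⟩ := fun i h => dif_pos h
    have hz2 : z (t + 1) = b := by simp [hz]
    have hzt : z t = a := by rw [hz1 t (by omega)]; exact hy.2
    have hfib : ∀ ω, Y ω = y ↔ ∀ i ≤ t, Z i ω = z i := by
      intro ω
      rw [funext_iff]
      constructor
      · intro h i hi
        rw [hz1 i (by omega)]
        exact h ⟨i, by omega⟩
      · intro h i
        rw [← hz1 i i.2]
        exact h i (by omega)
    have hav : ∀ ω, Y ω = y → ω ∈ avoidSet Z B t ∩ {ω | Z t ω = a} := by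
      rintro ω rfl
      exact ⟨fun i hi => hy.1 ⟨i, by omega⟩, hy.2⟩
    have h1 : Y ⁻¹' {y} ∩ (avoidSet Z B t ∩ {ω | Z t ω = a}) = {ω | ∀ i ≤ t, Z i ω = z i} := by
      ext ω
      simp only [Set.mem_inter_iff, Set.mem_preimage, Set.mem_singleton_iff, Set.mem_ofPred_eq]
      rw [← hfib]
      exact ⟨fun h => h.1, fun h => ⟨h, hav ω h⟩⟩
    have h2 : Y ⁻¹' {y} ∩ (avoidSet Z B t ∩ {ω | Z t ω = a} ∩ {ω | Z (t + 1) ω = b}) =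
        {ω | ∀ i ≤ t + 1, Z i ω = z i} := by
      ext ω
      simp only [Set.mem_inter_iff, Set.mem_preimage, Set.mem_singleton_iff, Set.mem_ofPred_eq]
      rw [hfib]
      constructor
      · rintro ⟨h, -, hb⟩ i hi
        rcases Nat.lt_or_ge t i with hi' | hi'
        · obtain rfl : i = t + 1 := by omega
          rw [hb, hz2]
        · exact h i hi'
      · intro h
        have h' : ∀ i ≤ t, Z i ω = z i := fun i hi => h i (by omega)
        exact ⟨h', hav ω ((hfib ω).2 h'), by rw [h (t + 1) le_rfl, hz2]⟩
    rw [h1, h2, hstep, hzt, hz2]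
  · have h1 : Y ⁻¹' {y} ∩ (avoidSet Z B t ∩ {ω | Z t ω = a}) = ∅ := by
      ext ω
      simp only [Set.mem_inter_iff, Set.mem_preimage, Set.mem_singleton_iff, Set.mem_ofPred_eq,
        Set.mem_empty_iff_false, iff_false]
      rintro ⟨rfl, h, h'⟩
      exact hy ⟨fun i => h i (by omega), h'⟩
    rw [← Set.inter_assoc, h1]
    simp

/-- Additive drift: if a potential `V ≥ 0` decreases in expectation by at least `δ` outside `B`,
then the probabilities that `B` is not hit up to time `t` have partial sums at most `M / δ`, where
`M` bounds `V`. -/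
theorem sum_measureReal_avoidSet_le (μ : Measure Ω) [IsProbabilityMeasure μ] {Z : ℕ → Ω → α}
    (hZ : ∀ t, Measurable (Z t)) {P : α → α → ℝ}
    (hstep : ∀ (t : ℕ) (z : ℕ → α), μ.real {ω | ∀ i ≤ t + 1, Z i ω = z i} =
      μ.real {ω | ∀ i ≤ t, Z i ω = z i} * P (z t) (z (t + 1)))
    (B : Set α) {V : α → ℝ} {M δ : ℝ} (hV0 : ∀ a, 0 ≤ V a) (hVM : ∀ a, V a ≤ M) (hδ : 0 < δ)
    (hdrift : ∀ a ∉ B, ∑ b, P a b * V b ≤ V a - δ) (m : ℕ) :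
    ∑ t ∈ Finset.range m, μ.real (avoidSet Z B t) ≤ M / δ := by
  classical
  set w : ℕ → ℝ := fun t => ∑ a, μ.real (avoidSet Z B t ∩ {ω | Z t ω = a}) * V a with hw
  have hfib : ∀ (s : ℕ) (A : Set Ω), μ.real A = ∑ a, μ.real (A ∩ {ω | Z s ω = a}) := by
    intro s A
    rw [measureReal_eq_sum_inter_fiber μ (hZ s) A]
    exact Finset.sum_congr rfl fun a _ => by rw [Set.inter_comm]; rfl
  have hw0 : ∀ t, 0 ≤ w t := fun t =>
    Finset.sum_nonneg fun a _ => mul_nonneg measureReal_nonneg (hV0 a)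
  have hwM : w 0 ≤ M := by
    have hM : 0 ≤ M := by
      obtain ⟨ω⟩ := nonempty_of_isProbabilityMeasure μ
      exact (hV0 (Z 0 ω)).trans (hVM _)
    calc w 0 ≤ ∑ a, μ.real (avoidSet Z B 0 ∩ {ω | Z 0 ω = a}) * M :=
          Finset.sum_le_sum fun a _ => mul_le_mul_of_nonneg_left (hVM a) measureReal_nonneg
      _ = μ.real (avoidSet Z B 0) * M := by rw [← Finset.sum_mul, ← hfib 0]
      _ ≤ 1 * M := mul_le_mul_of_nonneg_right measureReal_le_one hM
      _ = M := one_mul M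
  have hdec : ∀ t, w (t + 1) ≤ w t - δ * μ.real (avoidSet Z B t) := by
    intro t
    have hsub : avoidSet Z B (t + 1) ⊆ avoidSet Z B t := fun ω h i hi => h i (by omega)
    calc w (t + 1)
        ≤ ∑ b, μ.real (avoidSet Z B t ∩ {ω | Z (t + 1) ω = b}) * V b := by
          refine Finset.sum_le_sum fun b _ => mul_le_mul_of_nonneg_right ?_ (hV0 b)
          exact measureReal_mono (Set.inter_subset_inter_left _ hsub)
      _ = ∑ b, (∑ a, μ.real (avoidSet Z B t ∩ {ω | Z t ω = a}) * P a b) * V b := by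
          refine Finset.sum_congr rfl fun b _ => ?_
          rw [hfib t (avoidSet Z B t ∩ _)]
          congr 1
          refine Finset.sum_congr rfl fun a _ => ?_
          rw [← measureReal_avoidSet_step μ hZ hstep, Set.inter_right_comm]
      _ = ∑ a, μ.real (avoidSet Z B t ∩ {ω | Z t ω = a}) * ∑ b, P a b * V b := by
          simp only [Finset.sum_mul, Finset.mul_sum, mul_assoc]
          exact Finset.sum_comm
      _ ≤ ∑ a, μ.real (avoidSet Z B t ∩ {ω | Z t ω = a}) * (V a - δ) := by
          refine Finset.sum_le_sum fun a _ => ?_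
          -- States in `B` carry no mass on the avoidance event, so drift is needed only outside
          -- `B`.
          by_cases ha : a ∈ B
          · have : avoidSet Z B t ∩ {ω | Z t ω = a} = ∅ := by
              ext ω
              simp only [Set.mem_inter_iff, Set.mem_ofPred_eq, Set.mem_empty_iff_false, iff_false]
              rintro ⟨h, rfl⟩
              exact h t le_rfl ha
            simp [this]
          · exact mul_le_mul_of_nonneg_left (hdrift a ha) measureReal_nonneg
      _ = w t - δ * μ.real (avoidSet Z B t) := by
          simp only [mul_sub, Finset.sum_sub_distrib, hw]
          rw [← Finset.sum_mul, ← hfib t, mul_comm δ]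
  have htel : ∀ m, δ * ∑ t ∈ Finset.range m, μ.real (avoidSet Z B t) ≤ w 0 - w m := by
    intro m
    induction m with
    | zero => simp
    | succ m ih =>
      rw [Finset.sum_range_succ, mul_add]
      linarith [hdec m]
  rw [le_div_iff₀ hδ, mul_comm]
  linarith [htel m, hw0 m]

end Drift

/-! ### From tail sums to the expected runtime. -/

theorem runtime_le_tsum_indicator {n : ℕ} {Ω : Type*} (X : ℕ → Ω → BitString n) (ω : Ω) :
    (runtime X ω : ENNReal) ≤
      ∑' t : ℕ, {ω | ∀ i ≤ t, X i ω ≠ allOnes n}.indicator (fun _ => (1 : ENNReal)) ω := by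
  by_cases h : ∃ t, X t ω = allOnes n
  · classical
    have hle : runtime X ω ≤ (Nat.find h : ℕ∞) :=
      iInf₂_le (f := fun (t : ℕ) (_ : X t ω = allOnes n) => (t : ℕ∞)) _ (Nat.find_spec h)
    calc (runtime X ω : ENNReal) ≤ ((Nat.find h : ℕ∞) : ENNReal) := by exact_mod_cast hle
      _ = ∑ t ∈ Finset.range (Nat.find h), (1 : ENNReal) := by simp
      _ = ∑ t ∈ Finset.range (Nat.find h),
          {ω | ∀ i ≤ t, X i ω ≠ allOnes n}.indicator (fun _ => (1 : ENNReal)) ω := by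
          refine Finset.sum_congr rfl fun t ht => ?_
          rw [Set.indicator_of_mem]
          exact fun i hi => Nat.find_min h (lt_of_le_of_lt hi (Finset.mem_range.1 ht))
      _ ≤ _ := ENNReal.sum_le_tsum _
  -- If the optimum is never hit, every indicator is 1 and the series is infinite, matching the
  -- infinite runtime.
  · push Not at h
    have : ∀ t : ℕ, {ω | ∀ i ≤ t, X i ω ≠ allOnes n}.indicator (fun _ => (1 : ENNReal)) ω = 1 := by
      intro t
      rw [Set.indicator_of_mem]
      exact fun i _ => h i
    simp [this]

instance : MeasurableSingletonClass AcceptOp := ⟨fun _ => trivial⟩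

/-- The operator is part of the state, so that the pair is a Markov chain and `V` may depend on
both. The expectation of the runtime is bounded by the sum of its tail probabilities. -/
theorem expectedRuntime_le_of_drift {n : ℕ} {p q : ℝ} {f : BitString n → ℝ} {Ω : Type*}
    [MeasurableSpace Ω] (μ : Measure Ω) [IsProbabilityMeasure μ] {X : ℕ → Ω → BitString n}
    {S : ℕ → Ω → AcceptOp} (hrun : IsMMAHHRun p q f μ X S) {V : BitString n → AcceptOp → ℝ}
    {M δ : ℝ} (hV0 : ∀ x s, 0 ≤ V x s) (hVM : ∀ x s, V x s ≤ M) (hδ : 0 < δ)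
    (hdrift : ∀ x s, x ≠ allOnes n →
      ∑ y, ∑ r, moveProb f s x y * switchProb p q s r * V y r ≤ V x s - δ) :
    expectedRuntime μ X ≤ ENNReal.ofReal (M / δ) := by
  set Z : ℕ → Ω → BitString n × AcceptOp := fun t ω => (X t ω, S t ω) with hZdef
  have hZ : ∀ t, Measurable (Z t) := fun t => (hrun.measurable_X t).prodMk (hrun.measurable_S t)
  set B : Set (BitString n × AcceptOp) := {z | z.1 = allOnes n} with hB
  have hsum := sum_measureReal_avoidSet_le μ hZ
    (P := fun a b => moveProb f a.2 a.1 b.1 * switchProb p q a.2 b.2)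
    (by
      intro t z
      have := hrun.step t (fun i => (z i).1) (fun i => (z i).2)
      simpa only [hZdef, Prod.ext_iff] using this)
    B (V := fun a => V a.1 a.2) (fun a => hV0 _ _) (fun a => hVM _ _) hδ
    (by
      rintro ⟨x, s⟩ hx
      rw [Fintype.sum_prod_type]
      exact hdrift x s hx)
  have hset : ∀ t, {ω | ∀ i ≤ t, X i ω ≠ allOnes n} = avoidSet Z B t := fun t => rfl
  calc expectedRuntime μ X
      ≤ ∫⁻ ω, ∑' t : ℕ, (avoidSet Z B t).indicator (fun _ => (1 : ENNReal)) ω ∂μ :=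
        lintegral_mono fun ω => runtime_le_tsum_indicator X ω
    _ = ∑' t : ℕ, μ (avoidSet Z B t) := by
        rw [lintegral_tsum fun t =>
          (measurable_const.indicator (measurableSet_avoidSet hZ B t)).aemeasurable]
        refine tsum_congr fun t => ?_
        rw [lintegral_indicator_const (measurableSet_avoidSet hZ B t), one_mul]
    _ ≤ ENNReal.ofReal (M / δ) := by
        refine ENNReal.tsum_le_of_sum_range_le fun m => ?_
        calc ∑ t ∈ Finset.range m, μ (avoidSet Z B t)
            = ∑ t ∈ Finset.range m, ENNReal.ofReal (μ.real (avoidSet Z B t)) :=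
              Finset.sum_congr rfl fun t _ => (ofReal_measureReal).symm
          _ = ENNReal.ofReal (∑ t ∈ Finset.range m, μ.real (avoidSet Z B t)) :=
              (ENNReal.ofReal_sum_of_nonneg fun t _ => measureReal_nonneg).symm
          _ ≤ _ := ENNReal.ofReal_le_ofReal (hsum m)

/-! ### One-bit moves and the distance to the optimum. -/

section Moves

variable {n : ℕ}

theorem sum_moveProb_mul (f : BitString n → ℝ) (s : AcceptOp) (x : BitString n)
    (F : BitString n → ℝ) :
    ∑ y, moveProb f s x y * F y = (∑ v, F (nextSolution f s x v)) / n := by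
  classical
  simp only [moveProb, div_mul_eq_mul_div, ← Finset.sum_div]
  congr 1
  rw [← Finset.sum_fiberwise (s := Finset.univ) (g := fun v => nextSolution f s x v)]
  refine Finset.sum_congr rfl fun y _ => ?_
  rw [Finset.sum_congr rfl (g := fun _ => F y) fun v hv => by rw [(Finset.mem_filter.1 hv).2]]
  rw [Finset.sum_const, nsmul_eq_mul]

/-- Hamming distance to the optimum. -/
def distOpt (x : BitString n) : ℕ := hammingDist x (allOnes n)

theorem distOpt_eq_card (x : BitString n) :
    distOpt x = (Finset.univ.filter fun v => x v = false).card := by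
  simp [distOpt, hammingDist, allOnes]

theorem distOpt_le (x : BitString n) : distOpt x ≤ n := by
  simpa [distOpt] using hammingDist_le_card_fintype (x := x) (y := allOnes n)

theorem distOpt_eq_zero {x : BitString n} : distOpt x = 0 ↔ x = allOnes n := hammingDist_eq_zero

theorem distOpt_flipBit_of_false {x : BitString n} {v : Fin n} (hv : x v = false) :
    distOpt (flipBit x v) + 1 = distOpt x := by
  rw [distOpt_eq_card, distOpt_eq_card]
  have : (Finset.univ.filter fun u => x u = false) =
      insert v (Finset.univ.filter fun u => flipBit x v u = false) := by
    ext u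
    by_cases hu : u = v
    · subst hu; simp [hv]
    · have h : flipBit x v u = x u := Function.update_of_ne hu _ _
      rw [Finset.mem_insert, Finset.mem_filter_univ, Finset.mem_filter_univ, h]
      simp [hu]
  rw [this, Finset.card_insert_of_notMem (by simp [flipBit, hv])]

theorem distOpt_flipBit_of_true {x : BitString n} {v : Fin n} (hv : x v = true) :
    distOpt (flipBit x v) = distOpt x + 1 := by
  have h := distOpt_flipBit_of_false (x := flipBit x v) (v := v) (by simp [flipBit, hv])
  have h2 : flipBit (flipBit x v) v = x := by
    ext u
    simp [flipBit]
  rw [h2] at h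
  omega

end Moves

/-! ### Segments and accepted moves on SEQOPT functions. -/

/-- The operator that moves towards the optimum between the layers `d (l + 1)` and `d l`. -/
def goodOp (k l : ℕ) : AcceptOp := if Even (k - l) then .OI else .OW

theorem goodOp_succ_ne {k l : ℕ} (hl : l + 1 ≤ k) : goodOp k l ≠ goodOp k (l + 1) := by
  have h : Even (k - l) ↔ ¬ Even (k - (l + 1)) := by
    rw [← Nat.even_add_one, show k - (l + 1) + 1 = k - l by omega]
  unfold goodOp
  split_ifs <;> simp_all

theorem AcceptOp.eq_of_ne_of_ne {a b c : AcceptOp} (h₁ : a ≠ b) (h₂ : c ≠ b) : a = c := by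
  cases a <;> cases b <;> cases c <;> simp_all

/-- The segment of a positive distance `h`: the `l` with `d (l + 1) < h ≤ d l`. -/
def segmentIdx (k : ℕ) (d : ℕ → ℕ) (h : ℕ) : ℕ := Nat.findGreatest (fun l => h ≤ d l) k

namespace SeqOpt

variable {n k : ℕ} {d : ℕ → ℕ} {f : BitString n → ℝ}

theorem d_le_of_le (hf : SeqOpt n k d f) {l m : ℕ} (hlm : l ≤ m) (hm : m ≤ k + 1) :
    d m ≤ d l := by
  induction m, hlm using Nat.le_induction with
  | base => exact le_rfl
  | succ m _ ih => exact (hf.d_lt m (by omega)).le.trans (ih (by omega))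

theorem d_le (hf : SeqOpt n k d f) {l : ℕ} (hl : l ≤ k) : d l ≤ n :=
  (hf.d_le_of_le (Nat.zero_le l) (by omega)).trans hf.d_zero.le

theorem d_pos (hf : SeqOpt n k d f) {l : ℕ} (hl : l ≤ k) : 0 < d l :=
  (Nat.zero_le _).trans_lt (hf.d_lt l hl)

theorem segmentIdx_spec (hf : SeqOpt n k d f) {h : ℕ} (h0 : 0 < h) (hn : h ≤ n) :
    segmentIdx k d h ≤ k ∧ d (segmentIdx k d h + 1) < h ∧ h ≤ d (segmentIdx k d h) := by
  have hle : segmentIdx k d h ≤ k := Nat.findGreatest_le k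
  refine ⟨hle, ?_, ?_⟩
  · rcases hle.lt_or_eq with hlt | heq
    · exact not_le.1 (Nat.findGreatest_is_greatest (P := fun l => h ≤ d l)
        (Nat.lt_succ_self (segmentIdx k d h)) hlt)
    · rw [heq, hf.d_last]
      exact h0
  · exact Nat.findGreatest_spec (P := fun l => h ≤ d l) (Nat.zero_le k) (hn.trans hf.d_zero.ge)

theorem segmentIdx_eq (hf : SeqOpt n k d f) {h l : ℕ} (hl : l ≤ k) (h1 : d (l + 1) < h)
    (h2 : h ≤ d l) : segmentIdx k d h = l := by
  obtain ⟨a, b, c⟩ := hf.segmentIdx_spec (h := h) (by omega) (h2.trans (hf.d_le hl))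
  rcases lt_trichotomy (segmentIdx k d h) l with hlt | heq | hgt
  · have := hf.d_le_of_le (l := segmentIdx k d h + 1) (m := l) hlt (by omega)
    omega
  · exact heq
  · have := hf.d_le_of_le (l := l + 1) (m := segmentIdx k d h) hgt (by omega)
    omega

theorem accepts_iff (hf : SeqOpt n k d f) {l : ℕ} (hl : l ≤ k) {x y : BitString n}
    (hxy : distOpt y = distOpt x + 1) (h1 : d (l + 1) ≤ distOpt x) (h2 : distOpt x < d l)
    (s : AcceptOp) :
    (s.Accepts (f y) (f x) ↔ s = goodOp k l) ∧ (s.Accepts (f x) (f y) ↔ s ≠ goodOp k l) := by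
  unfold goodOp
  by_cases hev : Even (k - l)
  · have h := hf.increasing l hl hev (distOpt x) h1 h2 x rfl y hxy
    cases s <;> simp [AcceptOp.Accepts, hev, h, h.le]
  · have h := hf.decreasing l hl (Nat.not_even_iff_odd.1 hev) (distOpt x) h1 h2 x rfl y hxy
    cases s <;> simp [AcceptOp.Accepts, hev, h, h.le]

theorem nextSolution_of_false (hf : SeqOpt n k d f) {l : ℕ} (hl : l ≤ k) {x : BitString n}
    (h1 : d (l + 1) < distOpt x) (h2 : distOpt x ≤ d l) {v : Fin n} (hv : x v = false)
    (s : AcceptOp) :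
    nextSolution f s x v = if s = goodOp k l then flipBit x v else x := by
  have hd := distOpt_flipBit_of_false hv
  have := (hf.accepts_iff hl (x := flipBit x v) (y := x) hd.symm (by omega) (by omega) s).1
  simp [nextSolution, this]

/-- The upper bound is strict, unlike for moves towards the optimum: from distance `d l`, a move
away enters segment `l - 1`, where the good operator is the other one. -/
theorem nextSolution_of_true (hf : SeqOpt n k d f) {l : ℕ} (hl : l ≤ k) {x : BitString n}
    (h1 : d (l + 1) < distOpt x) (h2 : distOpt x < d l) {v : Fin n} (hv : x v = true)
    (s : AcceptOp) :
    nextSolution f s x v = if s = goodOp k l then x else flipBit x v := by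
  have hd := distOpt_flipBit_of_true hv
  have := (hf.accepts_iff hl (x := x) (y := flipBit x v) hd (by omega) (by omega) s).2
  unfold nextSolution
  split_ifs <;> tauto

/-- The layer `d l` is a trap for the wrong operator: moves inwards need the good operator of
segment `l`, and so do moves outwards, because the monotonicity reverses there. For `l = 0` there
are no moves outwards. -/
theorem nextSolution_of_distOpt_eq (hf : SeqOpt n k d f) {l : ℕ} (hl : l ≤ k) {x : BitString n}
    (hx : distOpt x = d l) (v : Fin n) {s : AcceptOp} (hs : s ≠ goodOp k l) :
    nextSolution f s x v = x := by
  cases hv : x v with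
  | false =>
    rw [hf.nextSolution_of_false hl (by rw [hx]; exact hf.d_lt l hl) hx.le hv, if_neg hs]
  | true =>
    have hd := distOpt_flipBit_of_true hv
    cases l with
    | zero =>
      have := distOpt_le (flipBit x v)
      have := hf.d_zero
      omega
    | succ l =>
      have := (hf.accepts_iff (l := l) (by omega) hd hx.ge
        (by rw [hx]; exact hf.d_lt l (by omega)) s).2
      have hs' : s = goodOp k l := AcceptOp.eq_of_ne_of_ne hs (goodOp_succ_ne hl)
      exact if_neg fun h => this.1 h hs'

end SeqOpt

/-! ### The two factors of the potential. -/

/-- Discount factor for descending from distance `h` to the optimum. -/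
noncomputable def discount (lam : ℝ) (h : ℕ) : ℝ := ∏ j ∈ Finset.range h, (1 + lam / (j + 1))⁻¹

section Discount

variable {lam : ℝ}

theorem discount_pos (hlam : 0 ≤ lam) (h : ℕ) : 0 < discount lam h :=
  Finset.prod_pos fun j _ => by positivity

theorem discount_eq (hlam : 0 ≤ lam) (h : ℕ) :
    discount lam h = discount lam (h + 1) * (1 + lam / (h + 1)) := by
  have : (1 + lam / ((h : ℝ) + 1)) ≠ 0 := by positivity
  rw [discount, discount, Finset.prod_range_succ, mul_assoc, inv_mul_cancel₀ this, mul_one]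

theorem discount_antitone (hlam : 0 ≤ lam) : Antitone (discount lam) := by
  refine antitone_nat_of_succ_le fun h => ?_
  rw [discount_eq hlam h]
  refine le_mul_of_one_le_right (discount_pos hlam _).le ?_
  have : 0 ≤ lam / ((h : ℝ) + 1) := by positivity
  linarith

theorem discount_le_one (hlam : 0 ≤ lam) (h : ℕ) : discount lam h ≤ 1 := by
  simpa [discount] using discount_antitone hlam (Nat.zero_le h)

/-- Combine 1 + t ≤ exp t in each factor with the bound 1 + log n on the harmonic number. -/
theorem exp_le_discount (hlam : 0 ≤ lam) (n : ℕ) :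
    Real.exp (-(lam * (1 + Real.log n))) ≤ discount lam n := by
  have hH : ∑ j ∈ Finset.range n, lam / ((j : ℝ) + 1) ≤ lam * (1 + Real.log n) := by
    have h := harmonic_le_one_add_log n
    simp only [harmonic, Rat.cast_sum, Rat.cast_inv, Rat.cast_natCast, Nat.cast_add,
      Nat.cast_one, Rat.cast_add, Rat.cast_one] at h
    calc ∑ j ∈ Finset.range n, lam / ((j : ℝ) + 1)
        = lam * ∑ j ∈ Finset.range n, ((j : ℝ) + 1)⁻¹ := by
          simp only [Finset.mul_sum, div_eq_mul_inv]
      _ ≤ _ := mul_le_mul_of_nonneg_left h hlam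
  calc Real.exp (-(lam * (1 + Real.log n)))
      ≤ Real.exp (∑ j ∈ Finset.range n, -(lam / ((j : ℝ) + 1))) := by
        rw [Finset.sum_neg_distrib]
        exact Real.exp_le_exp.2 (neg_le_neg hH)
    _ = ∏ j ∈ Finset.range n, Real.exp (-(lam / ((j : ℝ) + 1))) := Real.exp_sum _ _
    _ ≤ discount lam n := by
        refine Finset.prod_le_prod (fun j _ => (Real.exp_pos _).le) fun j _ => ?_
        rw [Real.exp_neg]
        have h0 : 0 < 1 + lam / ((j : ℝ) + 1) := by positivity
        refine inv_anti₀ h0 ?_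
        linarith [Real.add_one_le_exp (lam / ((j : ℝ) + 1))]

end Discount

/-- Lower bound for the chance of passing all local optima `d l, …, d k` in consecutive phases. -/
noncomputable def passWeight (n k : ℕ) (d : ℕ → ℕ) (l : ℕ) : ℝ :=
  ∏ j ∈ Finset.Ico l (k + 1), ((d j : ℝ) / (4 * n))

theorem passWeight_eq (n : ℕ) {k l : ℕ} (d : ℕ → ℕ) (hl : l ≤ k) :
    passWeight n k d l = (d l : ℝ) / (4 * n) * passWeight n k d (l + 1) :=
  Finset.prod_eq_prod_Ico_succ_bot (by omega) _

theorem passWeight_last (n k : ℕ) (d : ℕ → ℕ) : passWeight n k d (k + 1) = 1 := by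
  simp [passWeight]

namespace SeqOpt

variable {n k : ℕ} {d : ℕ → ℕ} {f : BitString n → ℝ}

theorem passWeight_pos (hf : SeqOpt n k d f) (l : ℕ) : 0 < passWeight n k d l := by
  refine Finset.prod_pos fun j hj => ?_
  have h1 := hf.d_pos (l := j) (by have := (Finset.mem_Ico.1 hj).2; omega)
  have h2 := hf.two_le
  positivity

theorem passWeight_le_succ (hf : SeqOpt n k d f) {l : ℕ} (hl : l ≤ k) :
    4 * passWeight n k d l ≤ passWeight n k d (l + 1) := by
  rw [passWeight_eq n d hl]
  have h1 : (d l : ℝ) ≤ n := by exact_mod_cast hf.d_le hl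
  have h2 : (0 : ℝ) < n := by have := hf.two_le; positivity
  have h3 := hf.passWeight_pos (l + 1)
  have h4 : (d l : ℝ) / n ≤ 1 := (div_le_one h2).2 h1
  have h5 : 4 * ((d l : ℝ) / (4 * n) * passWeight n k d (l + 1)) =
    (d l : ℝ) / n * passWeight n k d (l + 1) := by field_simp
  rw [h5]
  nlinarith

theorem passWeight_mono (hf : SeqOpt n k d f) {l m : ℕ} (hlm : l ≤ m) (hm : m ≤ k + 1) :
    passWeight n k d l ≤ passWeight n k d m := by
  induction m, hlm using Nat.le_induction with
  | base => exact le_rfl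
  | succ m _ ih =>
    have h1 := hf.passWeight_le_succ (l := m) (by omega)
    linarith [ih (by omega), hf.passWeight_pos m]

theorem passWeight_le_one (hf : SeqOpt n k d f) {l : ℕ} (hl : l ≤ k + 1) :
    passWeight n k d l ≤ 1 :=
  (hf.passWeight_mono hl le_rfl).trans (passWeight_last n k d).le

theorem inv_passWeight_zero (hf : SeqOpt n k d f) :
    (passWeight n k d 0)⁻¹ = 4 ^ (k + 1) * ((n : ℝ) ^ k / ∏ l ∈ Finset.Icc 1 k, (d l : ℝ)) := by
  have h2 : (n : ℝ) ≠ 0 := by have := hf.two_le; positivity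
  -- Since `d 0 = n`, the factor at `l = 0` is just 1 / 4; hence the exponent `k + 1` on 4 but only
  -- `k` on `n`.
  rw [passWeight_eq n d (Nat.zero_le k), hf.d_zero, passWeight, Finset.prod_div_distrib,
    Finset.prod_const, Nat.card_Ico]
  have h3 : Finset.Ico (0 + 1) (k + 1) = Finset.Icc 1 k := by ext; simp
  have h4 : (∏ l ∈ Finset.Icc 1 k, (d l : ℝ)) ≠ 0 := by
    refine Finset.prod_ne_zero_iff.2 fun l hl => ?_
    have := hf.d_pos (Finset.mem_Icc.1 hl).2
    positivity
  rw [h3, show k + 1 - (0 + 1) = k by omega, mul_pow, pow_succ]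
  field_simp

end SeqOpt

/-! ### The potential. -/

/-- The drift potential at distance `h` from the optimum while operator `s` is in use. -/
noncomputable def potential (n k : ℕ) (d : ℕ → ℕ) (lam : ℝ) (h : ℕ) (s : AcceptOp) : ℝ :=
  let l := segmentIdx k d h
  if h = 0 then 1
  else if s = goodOp k l then
    if h = d l then 2 * (discount lam h * passWeight n k d l)
    else discount lam h * passWeight n k d (l + 1)
  else if h = d l then discount lam h * passWeight n k d l
  else 0

namespace SeqOpt

variable {n k : ℕ} {d : ℕ → ℕ} {f : BitString n → ℝ} {lam : ℝ}

theorem potential_nonneg (hf : SeqOpt n k d f) (hlam : 0 ≤ lam) (h : ℕ) (s : AcceptOp) :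
    0 ≤ potential n k d lam h s := by
  have h1 := discount_pos hlam h
  have h2 := hf.passWeight_pos (segmentIdx k d h)
  have h3 := hf.passWeight_pos (segmentIdx k d h + 1)
  simp only [potential]
  split_ifs <;> positivity

theorem potential_le_one (hf : SeqOpt n k d f) (hlam : 0 ≤ lam) {h : ℕ} (s : AcceptOp) :
    potential n k d lam h s ≤ 1 := by
  have hle : segmentIdx k d h ≤ k := Nat.findGreatest_le k
  have h0 := discount_pos hlam h
  have h1 := discount_le_one hlam h
  have h2 := hf.passWeight_pos (segmentIdx k d h)
  have h3 := hf.passWeight_le_succ hle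
  have h4 := hf.passWeight_le_one (l := segmentIdx k d h + 1) (by omega)
  simp only [potential]
  split_ifs <;> nlinarith

/-- The worst value under a good operator. It is what a switch regains from a state of potential 0,
and it determines the drift rate. -/
theorem potential_good_ge (hf : SeqOpt n k d f) (hlam : 0 ≤ lam) {h l : ℕ} (hl : l ≤ k)
    (h1 : d (l + 1) < h) (h2 : h ≤ d l) :
    discount lam n * passWeight n k d 0 ≤ potential n k d lam h (goodOp k l) := by
  have hE := discount_antitone hlam (h2.trans (hf.d_le hl))
  have hE0 := discount_pos hlam n
  have hb0 := hf.passWeight_pos 0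
  have hb := hf.passWeight_mono (Nat.zero_le l) (by omega)
  have hb' := hf.passWeight_mono (Nat.zero_le (l + 1)) (by omega)
  have e1 := mul_le_mul hE hb hb0.le (hE0.le.trans hE)
  have e2 := mul_le_mul hE hb' hb0.le (hE0.le.trans hE)
  have e3 := mul_pos hE0 hb0
  simp only [potential, hf.segmentIdx_eq hl h1 h2, if_true]
  rw [if_neg (by omega)]
  split_ifs <;> linarith

/-- Value after a step towards the optimum with the good operator of segment `l`. -/
theorem potential_pred (hf : SeqOpt n k d f) {h l : ℕ} (hl : l ≤ k) (h1 : d (l + 1) ≤ h)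
    (h2 : h < d l) :
    potential n k d lam h (goodOp k l) = discount lam h * passWeight n k d (l + 1) := by
  rcases h1.lt_or_eq with h1 | h1
  · simp only [potential, hf.segmentIdx_eq hl h1 h2.le, if_true]
    rw [if_neg (by omega), if_neg h2.ne]
  -- At `h = d (l + 1)` the same operator has become the wrong one, and the waiting value of the
  -- trap matches the value inside segment `l`. For `l = k` this layer is the optimum, of value 1.
  · rcases hl.lt_or_eq with hlk | rfl
    · have h3 := hf.d_lt (l + 1) hlk
      simp only [potential, hf.segmentIdx_eq (l := l + 1) hlk (by omega) h1.ge,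
        if_neg (goodOp_succ_ne hlk), if_pos h1.symm]
      rw [if_neg (by omega)]
    · have h0 : h = 0 := by rw [← h1, hf.d_last]
      subst h0
      simp [potential, passWeight_last, discount]

end SeqOpt

/-! ### Drift of the potential. -/

theorem exists_sum_switchProb_eq (p q : ℝ) (s : AcceptOp) :
    ∃ (e : ℝ) (s' : AcceptOp), (e = p ∨ e = q) ∧ s' ≠ s ∧
      ∀ F : AcceptOp → ℝ, ∑ r, switchProb p q s r * F r = (1 - e) * F s + e * F s' := by
  have hu : (Finset.univ : Finset AcceptOp) = {AcceptOp.OI, AcceptOp.OW} := rfl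
  cases s with
  | OI => exact ⟨p, .OW, .inl rfl, by simp, fun F => by simp [hu, switchProb]⟩
  | OW => exact ⟨q, .OI, .inr rfl, by simp, fun F => by simp [hu, switchProb, add_comm]⟩

theorem sum_ite_bit {n : ℕ} (x : BitString n) (D U : ℝ) :
    ∑ v, (if x v = false then D else U) = distOpt x * D + (n - distOpt x) * U := by
  rw [Finset.sum_ite, Finset.sum_const, Finset.sum_const, nsmul_eq_mul, nsmul_eq_mul,
    ← distOpt_eq_card]
  congr 2
  have h := Finset.card_filter_add_card_filter_not (s := (Finset.univ : Finset (Fin n)))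
    (fun v => x v = false)
  rw [← distOpt_eq_card, Finset.card_univ, Fintype.card_fin] at h
  rw [eq_sub_iff_add_eq, add_comm]
  exact_mod_cast h

namespace SeqOpt

variable {n k : ℕ} {d : ℕ → ℕ} {f : BitString n → ℝ} {P ρ e : ℝ}

/-- The gain comes only from switching to the good operator. Strictly inside a segment the potential
is 0 and the wrong operator cannot leave the segment in one step; in the trap at `d l` the solution
stays put and a switch doubles the potential. -/
theorem drift_of_ne_goodOp (hf : SeqOpt n k d f) {lam : ℝ} (hlam : 0 ≤ lam) (hρ : 0 < ρ)
    (hρe : ρ ≤ e) (he : e ≤ 1) {l : ℕ} (hl : l ≤ k) {x : BitString n}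
    (h1 : d (l + 1) < distOpt x) (h2 : distOpt x ≤ d l) {s : AcceptOp} (hs : s ≠ goodOp k l) :
    potential n k d lam (distOpt x) s + ρ * (discount lam n * passWeight n k d 0) ≤
      (∑ v, ((1 - e) * potential n k d lam (distOpt (nextSolution f s x v)) s +
        e * potential n k d lam (distOpt (nextSolution f s x v)) (goodOp k l))) / n := by
  have hn : (0 : ℝ) < n := by have := hf.two_le; positivity
  have hm : 0 < discount lam n * passWeight n k d 0 :=
    mul_pos (discount_pos hlam n) (hf.passWeight_pos 0)
  rw [le_div_iff₀ hn]
  suffices h : ∀ v, potential n k d lam (distOpt x) s +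
      ρ * (discount lam n * passWeight n k d 0) ≤
      (1 - e) * potential n k d lam (distOpt (nextSolution f s x v)) s +
        e * potential n k d lam (distOpt (nextSolution f s x v)) (goodOp k l) by
    have := Finset.card_nsmul_le_sum Finset.univ _ _ fun v _ => h v
    rw [Finset.card_univ, Fintype.card_fin, nsmul_eq_mul] at this
    linarith
  intro v
  rcases h2.lt_or_eq with h2 | h2
  · have h0 : potential n k d lam (distOpt x) s = 0 := by
      simp only [potential, hf.segmentIdx_eq hl h1 h2.le, if_neg hs, if_neg h2.ne]
      rw [if_neg (by omega)]
    have hnext : distOpt x ≤ distOpt (nextSolution f s x v) ∧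
        distOpt (nextSolution f s x v) ≤ distOpt x + 1 := by
      cases hv : x v with
      | false => simp [hf.nextSolution_of_false hl h1 h2.le hv, hs]
      | true => simp [hf.nextSolution_of_true hl h1 h2 hv, hs, distOpt_flipBit_of_true hv]
    have hg := hf.potential_good_ge hlam hl (h1.trans_le hnext.1) (by omega)
    have hnn := hf.potential_nonneg hlam (distOpt (nextSolution f s x v)) s
    -- Only the switching term is kept; it is at least ρ times the worst good value.
    rw [h0, zero_add]
    have e1 := mul_le_mul hρe hg hm.le (hρ.le.trans hρe)
    have e2 := mul_nonneg (sub_nonneg.2 he) hnn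
    linarith
  · rw [hf.nextSolution_of_distOpt_eq hl h2 v hs]
    have hx0 : distOpt x ≠ 0 := by omega
    have e1 : potential n k d lam (distOpt x) (goodOp k l) =
        2 * potential n k d lam (distOpt x) s := by
      simp only [potential, hf.segmentIdx_eq hl h1 h2.le, if_neg hs, if_pos h2, if_neg hx0, if_true]
    have hE := discount_antitone hlam (distOpt_le x)
    have hb := hf.passWeight_mono (Nat.zero_le l) (by omega)
    have e2 : discount lam n * passWeight n k d 0 ≤ potential n k d lam (distOpt x) s := by
      simp only [potential, hf.segmentIdx_eq hl h1 h2.le, if_neg hs, if_pos h2, if_neg hx0]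
      exact mul_le_mul hE hb (hf.passWeight_pos 0).le (discount_pos hlam _).le
    rw [e1]
    have e3 := mul_le_mul hρe e2 hm.le (hρ.le.trans hρe)
    linarith

/-- A switch is treated as losing everything: its nonnegative contribution is dropped. The expected
gain of the move must outweigh the factor 1 - e, which fixes the discount parameter 3nP and the
constant 4 in the pass weight. -/
theorem drift_of_eq_goodOp (hf : SeqOpt n k d f) (hP : P ≤ 1 / 4) (hρ : 0 < ρ)
    (hρe : ρ ≤ e) (he : e ≤ P) {l : ℕ} (hl : l ≤ k) {x : BitString n}
    (h1 : d (l + 1) < distOpt x) (h2 : distOpt x ≤ d l) (s' : AcceptOp) :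
    potential n k d (3 * n * P) (distOpt x) (goodOp k l) +
        ρ * (discount (3 * n * P) n * passWeight n k d 0) ≤
      (∑ v, ((1 - e) * potential n k d (3 * n * P) (distOpt (nextSolution f (goodOp k l) x v))
          (goodOp k l) +
        e * potential n k d (3 * n * P) (distOpt (nextSolution f (goodOp k l) x v)) s')) / n := by
  have hn : (0 : ℝ) < n := by have := hf.two_le; positivity
  have hP0 : 0 < P := by linarith
  set lam : ℝ := 3 * n * P with hlamdef
  have hlam : 0 ≤ lam := by positivity
  have he0 : 0 < 1 - e := by linarith
  obtain ⟨h, hh⟩ : ∃ h, distOpt x = h + 1 := ⟨distOpt x - 1, by omega⟩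
  have hhR : (distOpt x : ℝ) = h + 1 := by exact_mod_cast hh
  have hE := discount_eq hlam h
  have hEpos := discount_pos hlam (h + 1)
  have hEn := discount_antitone hlam (show h + 1 ≤ n by rw [← hh]; exact distOpt_le x)
  have hEn0 := discount_pos hlam n
  have hb0 := hf.passWeight_pos 0
  have hdown : ∀ v, x v = false →
      potential n k d lam (distOpt (nextSolution f (goodOp k l) x v)) (goodOp k l) =
        discount lam h * passWeight n k d (l + 1) := by
    intro v hv
    have hd := distOpt_flipBit_of_false hv
    rw [hf.nextSolution_of_false hl h1 h2 hv, if_pos rfl, hf.potential_pred hl (by omega) (by omega),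
      show distOpt (flipBit x v) = h by omega]
  have hnn : ∀ v r, 0 ≤ potential n k d lam (distOpt (nextSolution f (goodOp k l) x v)) r :=
    fun v r => hf.potential_nonneg hlam _ r
  have key : ∀ U : ℝ, (∀ v, x v = true →
      U ≤ potential n k d lam (distOpt (nextSolution f (goodOp k l) x v)) (goodOp k l)) →
      (1 - e) * ((h + 1) * (discount lam h * passWeight n k d (l + 1)) + (n - (h + 1)) * U) ≤
        ∑ v, ((1 - e) * potential n k d lam (distOpt (nextSolution f (goodOp k l) x v))
          (goodOp k l) +
        e * potential n k d lam (distOpt (nextSolution f (goodOp k l) x v)) s') := by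
    intro U hU
    rw [← hhR, ← sum_ite_bit, Finset.mul_sum]
    refine Finset.sum_le_sum fun v _ => ?_
    have h3 : (if x v = false then discount lam h * passWeight n k d (l + 1) else U) ≤
        potential n k d lam (distOpt (nextSolution f (goodOp k l) x v)) (goodOp k l) := by
      split_ifs with hv
      · exact (hdown v hv).ge
      · exact hU v (by simpa using hv)
    have e1 := mul_le_mul_of_nonneg_left h3 he0.le
    have e2 := mul_nonneg (hρ.le.trans hρe) (hnn v s')
    linarith
  have hx0 : distOpt x ≠ 0 := by omega
  have hstep : ((h : ℝ) + 1) * discount lam h = discount lam (h + 1) * (h + 1 + lam) := by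
    rw [hE]; field_simp
  rw [le_div_iff₀ hn]
  rcases h2.lt_or_eq with h2 | h2
  · have hW := hf.potential_pred (lam := lam) hl h1.le h2
    refine le_trans ?_ (key (discount lam (distOpt x) * passWeight n k d (l + 1)) ?_)
    · rw [hW, hh]
      set E := discount lam (h + 1)
      set b := passWeight n k d (l + 1)
      have hb : 0 < b := hf.passWeight_pos _
      have hm : discount lam n * passWeight n k d 0 ≤ E * b :=
        mul_le_mul hEn (hf.passWeight_mono (Nat.zero_le _) (by omega)) hb0.le hEpos.le
      -- The discount recursion makes the mean after a move exactly 1 + λ / n = 1 + 3P times the old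
      -- value, at every distance strictly inside the segment.
      have e1 : (1 - e) * ((h + 1) * (discount lam h * b) + (n - (h + 1)) * (E * b)) =
          (1 - e) * (1 + 3 * P) * (E * b) * n := by
        rw [← mul_assoc ((h : ℝ) + 1), hstep, hlamdef]; ring
      rw [e1]
      refine mul_le_mul_of_nonneg_right ?_ hn.le
      -- As ρ ≤ e ≤ P ≤ 1 / 4, the right side is at least 1 + 2P - 3P² ≥ 1 + P.
      have e2 : 1 + ρ ≤ (1 - e) * (1 + 3 * P) := by nlinarith
      have e3 := mul_le_mul_of_nonneg_right e2 (mul_pos hEpos hb).le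
      have e4 := mul_le_mul_of_nonneg_left hm hρ.le
      linarith
    · intro v hv
      rw [hf.nextSolution_of_true hl h1 h2 hv, if_pos rfl, hW]
  · have hW : potential n k d lam (distOpt x) (goodOp k l) =
        2 * (discount lam (h + 1) * passWeight n k d l) := by
      simp only [potential, hf.segmentIdx_eq hl h1 h2.le, if_pos h2, if_neg hx0, if_true]
      rw [hh]
    -- At `d l` moves away from the optimum may be accepted, so they are credited with nothing.
    refine le_trans ?_ (key 0 fun v _ => hnn v _)
    rw [hW]
    have hpw : ((h : ℝ) + 1) * passWeight n k d (l + 1) = 4 * n * passWeight n k d l := by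
      rw [passWeight_eq n d hl, ← h2, hhR]; field_simp
    have hEh : discount lam (h + 1) ≤ discount lam h := discount_antitone hlam (Nat.le_succ h)
    set E := discount lam (h + 1)
    set b := passWeight n k d l
    have hb : 0 < b := hf.passWeight_pos _
    have hm : discount lam n * passWeight n k d 0 ≤ E * b :=
      mul_le_mul hEn (hf.passWeight_mono (Nat.zero_le _) (by omega)) hb0.le hEpos.le
    have e1 : (1 - e) * ((h + 1) * (discount lam h * passWeight n k d (l + 1)) +
        (n - (h + 1)) * 0) = 4 * (1 - e) * (discount lam h * b) * n := by
      linear_combination (1 - e) * discount lam h * hpw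
    rw [e1]
    refine mul_le_mul_of_nonneg_right ?_ hn.le
    have e2 := mul_le_mul_of_nonneg_right hEh hb.le
    have e3 := mul_pos hEpos hb
    have e4 := mul_le_mul_of_nonneg_left hm hρ.le
    -- The weight 4 leaves at least 4(1 - e) ≥ 3 units of `E * b`: two restore the old value, and
    -- the third covers the drift.
    have e5 : ρ * (E * b) ≤ 1 * (E * b) := mul_le_mul_of_nonneg_right (by linarith) e3.le
    have e6 : 3 * (E * b) ≤ 4 * (1 - e) * (discount lam h * b) :=
      mul_le_mul (by linarith) e2 e3.le (by linarith)
    linarith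

/-- Explicit runtime bound: `ρ ≤ P` are a lower and an upper bound for both switching
probabilities. -/
theorem expectedRuntime_le (hf : SeqOpt n k d f) {p q : ℝ} (hP : P ≤ 1 / 4) (hρ : 0 < ρ)
    (hp : ρ ≤ p) (hp' : p ≤ P) (hq : ρ ≤ q) (hq' : q ≤ P) {Ω : Type*} [MeasurableSpace Ω]
    (μ : Measure Ω) [IsProbabilityMeasure μ] {X : ℕ → Ω → BitString n} {S : ℕ → Ω → AcceptOp}
    (hrun : IsMMAHHRun p q f μ X S) :
    expectedRuntime μ X ≤
      ENNReal.ofReal (1 / (ρ * (discount (3 * n * P) n * passWeight n k d 0))) := by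
  have hn : (0 : ℝ) < n := by have := hf.two_le; positivity
  have hP0 : 0 ≤ P := by linarith
  have hlam : 0 ≤ 3 * n * P := by positivity
  refine expectedRuntime_le_of_drift μ hrun
    (V := fun x s => 1 - potential n k d (3 * n * P) (distOpt x) s)
    (fun x s => sub_nonneg.2 (hf.potential_le_one hlam s))
    (fun x s => by linarith [hf.potential_nonneg hlam (distOpt x) s])
    (mul_pos hρ (mul_pos (discount_pos hlam n) (hf.passWeight_pos 0))) fun x s hx => ?_
  obtain ⟨e, s', he, hs', hsw⟩ := exists_sum_switchProb_eq p q s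
  have hρe : ρ ≤ e := by rcases he with rfl | rfl <;> assumption
  have heP : e ≤ P := by rcases he with rfl | rfl <;> assumption
  simp only [mul_assoc (moveProb _ _ _ _), ← Finset.mul_sum, hsw, sum_moveProb_mul]
  have hpos : 0 < distOpt x := Nat.pos_of_ne_zero fun h => hx (distOpt_eq_zero.1 h)
  obtain ⟨hl, h1, h2⟩ := hf.segmentIdx_spec hpos (distOpt_le x)
  have hdrift : potential n k d (3 * n * P) (distOpt x) s +
      ρ * (discount (3 * n * P) n * passWeight n k d 0) ≤
      (∑ v, ((1 - e) * potential n k d (3 * n * P) (distOpt (nextSolution f s x v)) s +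
        e * potential n k d (3 * n * P) (distOpt (nextSolution f s x v)) s')) / n := by
    by_cases hs : s = goodOp k (segmentIdx k d (distOpt x))
    · rw [hs]
      exact hf.drift_of_eq_goodOp hP hρ hρe heP hl h1 h2 s'
    · rw [AcceptOp.eq_of_ne_of_ne hs' (Ne.symm hs)]
      exact hf.drift_of_ne_goodOp hlam hρ hρe (by linarith) hl h1 h2 hs
  have hsum : (∑ v, ((1 - e) * (1 - potential n k d (3 * n * P)
      (distOpt (nextSolution f s x v)) s) + e * (1 - potential n k d (3 * n * P)
      (distOpt (nextSolution f s x v)) s'))) / n =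
      1 - (∑ v, ((1 - e) * potential n k d (3 * n * P) (distOpt (nextSolution f s x v)) s +
        e * potential n k d (3 * n * P) (distOpt (nextSolution f s x v)) s')) / n := by
    rw [eq_sub_iff_add_eq, ← add_div, ← Finset.sum_add_distrib, div_eq_one_iff_eq hn.ne',
      Finset.sum_congr rfl (g := fun _ => (1 : ℝ)) fun v _ => by ring]
    simp
  linarith

end SeqOpt

/-! ### Asymptotic form of the bound. -/

theorem mainTheorem1 (K : ℕ) (c₁ c₂ : ℝ) (hc₁ : 0 < c₁) (hc₂ : 0 < c₂) :
    ∃ C : ℝ, 0 < C ∧ ∃ N : ℕ, ∀ n : ℕ, N ≤ n →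
      ∀ p q : ℝ, 0 < p → p < 1 → 0 < q → q < 1 →
        c₁ * (1 / (n * Real.log n)) ≤ p → p ≤ c₂ * (1 / (n * Real.log n)) →
        c₁ * (1 / (n * Real.log n)) ≤ q → q ≤ c₂ * (1 / (n * Real.log n)) →
        ∀ (k : ℕ) (d : ℕ → ℕ) (f : BitString n → ℝ), k ≤ K → SeqOpt n k d f →
          ∀ (Ω : Type*) [MeasurableSpace Ω] (μ : MeasureTheory.Measure Ω)
            [MeasureTheory.IsProbabilityMeasure μ]
            (X : ℕ → Ω → BitString n) (S : ℕ → Ω → AcceptOp), IsMMAHHRun p q f μ X S →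
            expectedRuntime μ X ≤
              ENNReal.ofReal (C * ((n : ℝ) ^ (k + 1) / (∏ l ∈ Finset.Icc 1 k, (d l : ℝ)) *
                Real.log n)) := by
  -- In `C`, the power of 4 comes from the pass weight, the exponential from the inverse discount,
  -- and 1 / c₁ from 1 / ρ. The threshold 3 > e gives log n ≥ 1, and n ≥ 4c₂ then gives P ≤ 1 / 4.
  refine ⟨4 ^ (K + 1) * Real.exp (6 * c₂) / c₁, by positivity, max 3 ⌈4 * c₂⌉₊, ?_⟩
  intro n hN p q _ _ _ _ hp hp' hq hq' k d f hk hf Ω _ μ _ X S hrun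
  have hn3 : (3 : ℝ) ≤ n := by exact_mod_cast (le_max_left _ _).trans hN
  have hn4 : 4 * c₂ ≤ n := (Nat.le_ceil _).trans (by exact_mod_cast (le_max_right _ _).trans hN)
  have hn : (0 : ℝ) < n := by linarith
  have hlog : 1 ≤ Real.log n := by
    rw [Real.le_log_iff_exp_le hn]
    linarith [Real.exp_one_lt_d9]
  have hlog0 : 0 < Real.log n := by linarith
  have hprod : 0 < ∏ l ∈ Finset.Icc 1 k, (d l : ℝ) :=
    Finset.prod_pos fun l hl => by exact_mod_cast hf.d_pos (Finset.mem_Icc.1 hl).2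
  have hP : c₂ * (1 / (n * Real.log n)) ≤ 1 / 4 := by
    rw [mul_one_div, div_le_iff₀ (by positivity)]
    nlinarith
  have hbound := hf.expectedRuntime_le hP (by positivity) hp hp' hq hq' μ hrun
  refine hbound.trans (ENNReal.ofReal_le_ofReal ?_)
  set lam : ℝ := 3 * n * (c₂ * (1 / (n * Real.log n))) with hlamdef
  have hlam : lam = 3 * c₂ / Real.log n := by rw [hlamdef]; field_simp
  have hlam0 : 0 ≤ lam := by rw [hlam]; positivity
  have hE : (discount lam n)⁻¹ ≤ Real.exp (6 * c₂) := by
    rw [inv_le_comm₀ (discount_pos hlam0 n) (Real.exp_pos _), ← Real.exp_neg]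
    refine le_trans (Real.exp_le_exp.2 (neg_le_neg ?_)) (exp_le_discount hlam0 n)
    -- Here λ = 3c₂ / log n, so λ (1 + log n) ≤ 6c₂ because log n ≥ 1.
    rw [hlam, div_mul_eq_mul_div, div_le_iff₀ hlog0]
    nlinarith
  have h4 : (4 : ℝ) ^ (k + 1) ≤ 4 ^ (K + 1) := pow_le_pow_right₀ (by norm_num) (by omega)
  have heq : 1 / (c₁ * (1 / (n * Real.log n)) * (discount lam n * passWeight n k d 0)) =
      n * Real.log n / c₁ * (n ^ k / ∏ l ∈ Finset.Icc 1 k, (d l : ℝ)) *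
        (4 ^ (k + 1) * (discount lam n)⁻¹) := by
    rw [one_div, mul_inv, mul_inv, mul_inv, hf.inv_passWeight_zero]
    field_simp
  have heq' : 4 ^ (K + 1) * Real.exp (6 * c₂) / c₁ *
      ((n : ℝ) ^ (k + 1) / (∏ l ∈ Finset.Icc 1 k, (d l : ℝ)) * Real.log n) =
      n * Real.log n / c₁ * (n ^ k / ∏ l ∈ Finset.Icc 1 k, (d l : ℝ)) *
        (4 ^ (K + 1) * Real.exp (6 * c₂)) := by
    rw [pow_succ (n : ℝ)]
    field_simp
  rw [heq, heq']
  refine mul_le_mul_of_nonneg_left ?_ (by positivity)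
  exact mul_le_mul h4 hE (inv_nonneg.2 (discount_pos hlam0 n).le) (by positivity)
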